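/- Let $n,k$ be integers with $1\le k\le n-1$. Let $\mathcal P(n,k)$ be the $k$-nearest-neighbor platoon: the undirected simple graph on vertices $v_1,\dots,v_n$ in which $v_i$ and $v_j$ ($i\ne j$) are adjacent if and only if $|i-j|\le k$. Let $L=D-A$ be its Laplacian matrix ($D$ the diagonal matrix of vertex degrees, $A$ the adjacency matrix), with eigenvalues $0=\lambda_1(L)\le\lambda_2(L)\le\dots\le\lambda_n(L)$ listed with multiplicity, and put $\bar n=\lfloor n/2\rfloor$. Then the algebraic connectivity $\lambda_2(L)$ satisfies $$\max\left\{2k-n+2,\ \frac{k(k+1)^2}{16\,\bar n^2}\right\}\ \le\ \lambda_2(L)\ \le\ \frac{2k(k+1)}{\bar n}.$$ -/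

import Mathlib

/-- The `k`-nearest neighbor platoon on `n` vehicles in a line: distinct vehicles communicate
iff their positions differ by at most `k`. -/
def platoon (n k : ℕ) : SimpleGraph (Fin n) where
  Adj i j := i ≠ j ∧ (i : ℕ) ≤ (j : ℕ) + k ∧ (j : ℕ) ≤ (i : ℕ) + k
  symm := ⟨fun _ _ h => ⟨h.1.symm, h.2.2, h.2.1⟩⟩
  loopless := ⟨fun _ h => h.1 rfl⟩

instance platoon.instDecidableRelAdj (n k : ℕ) : DecidableRel (platoon n k).Adj := fun i j =>
  inferInstanceAs (Decidable (i ≠ j ∧ (i : ℕ) ≤ (j : ℕ) + k ∧ (j : ℕ) ≤ (i : ℕ) + k))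

/-- The eigenvalues of the Laplacian matrix `D - A` of a finite graph, listed with multiplicity
in nondecreasing order (Mathlib's `eigenvalues₀` lists them in nonincreasing order). -/
noncomputable def laplacianEigenvalue {V : Type*} [Fintype V] [DecidableEq V]
    (G : SimpleGraph V) [DecidableRel G.Adj] (i : Fin (Fintype.card V)) : ℝ :=
  (G.isHermitian_lapMatrix (R := ℝ)).eigenvalues₀ i.rev

/-- The algebraic connectivity of a graph with at least two vertices: the second smallest
eigenvalue, counted with multiplicity, of its Laplacian matrix. -/
noncomputable def algebraicConnectivity {V : Type*} [Fintype V] [DecidableEq V]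
    (G : SimpleGraph V) [DecidableRel G.Adj] (hV : 1 < Fintype.card V) : ℝ :=
  laplacianEigenvalue G ⟨1, hV⟩

theorem one_lt_card_fin_of_lt {n k : ℕ} (hk : 1 ≤ k) (hkn : k < n) :
    1 < Fintype.card (Fin n) := by
  rw [Fintype.card_fin]
  omega

/-! All three bounds compare `x ⬝ᵥ L *ᵥ x` with `x ⬝ᵥ x` for vectors `x` of sum zero.

Degree bound: on such `x` the Laplacians of `G` and `Gᶜ` add up to `n`. Degrees in `Gᶜ` are at most
`n - 1 - k`, so its form is at most `2 (n - 1 - k)`, leaving `2k - n + 2`.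

Poincaré bound: let `E d` be the sum of squared differences at lag `d`. The platoon's form is the
sum of `E d` over `d ≤ k`, and `n (x ⬝ᵥ x)` is the sum over all `d < n`. Since `√E` is subadditive
in the lag, long lags are controlled by short ones (`mul_sum_lagEnergy_le`).

Upper bound: test with the vector that is constant on each side of a cut at `n / 2`. -/

open Matrix

/-! ### Spectral expansion in the order of `eigenvalues₀`. -/

namespace Matrix.IsHermitian

variable {V : Type*} [Fintype V] [DecidableEq V] {A : Matrix V V ℝ} (hA : A.IsHermitian)

/-- The orthonormal eigenvectors of a real symmetric matrix, as plain functions, in the order of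
`eigenvalues₀`. -/
noncomputable def eigenvector₀ (i : Fin (Fintype.card V)) : V → ℝ :=
  ⇑(hA.eigenvectorBasis (Fintype.equivOfCardEq (Fintype.card_fin _) i))

theorem mulVec_eigenvector₀ (i : Fin (Fintype.card V)) :
    A *ᵥ hA.eigenvector₀ i = hA.eigenvalues₀ i • hA.eigenvector₀ i := by
  simp [eigenvector₀, mulVec_eigenvectorBasis, eigenvalues]

theorem eigenvector₀_dotProduct (i j : Fin (Fintype.card V)) :
    hA.eigenvector₀ i ⬝ᵥ hA.eigenvector₀ j = if i = j then 1 else 0 := by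
  have h := orthonormal_iff_ite.1 hA.eigenvectorBasis.orthonormal
    (Fintype.equivOfCardEq (Fintype.card_fin _) i) (Fintype.equivOfCardEq (Fintype.card_fin _) j)
  rw [EuclideanSpace.inner_eq_star_dotProduct, dotProduct_comm] at h
  simpa [eigenvector₀] using h

theorem sum_dotProduct_smul_eigenvector₀ (x : V → ℝ) :
    ∑ i, (hA.eigenvector₀ i ⬝ᵥ x) • hA.eigenvector₀ i = x := by
  have h := hA.eigenvectorBasis.sum_repr' (WithLp.toLp 2 x)
  rw [← (Fintype.equivOfCardEq (Fintype.card_fin (Fintype.card V))).sum_comp] at h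
  have h2 := congrArg (WithLp.ofLp) h
  rw [WithLp.ofLp_sum] at h2
  simpa [eigenvector₀, EuclideanSpace.inner_eq_star_dotProduct, dotProduct_comm] using h2

theorem dotProduct_self_eq_sum (x : V → ℝ) :
    x ⬝ᵥ x = ∑ i, (hA.eigenvector₀ i ⬝ᵥ x) ^ 2 := by
  conv_lhs => rw [← hA.sum_dotProduct_smul_eigenvector₀ x, sum_dotProduct]
  refine Finset.sum_congr rfl fun i _ => ?_
  rw [hA.sum_dotProduct_smul_eigenvector₀ x, smul_dotProduct, smul_eq_mul, sq]

theorem dotProduct_mulVec_eq_sum (x : V → ℝ) :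
    x ⬝ᵥ A *ᵥ x = ∑ i, hA.eigenvalues₀ i * (hA.eigenvector₀ i ⬝ᵥ x) ^ 2 := by
  have h : A *ᵥ x = ∑ i, (hA.eigenvector₀ i ⬝ᵥ x) • hA.eigenvalues₀ i • hA.eigenvector₀ i := by
    conv_lhs => rw [← hA.sum_dotProduct_smul_eigenvector₀ x]
    simp [mulVec_sum, mulVec_smul, mulVec_eigenvector₀]
  rw [h, dotProduct_sum]
  refine Finset.sum_congr rfl fun i _ => ?_
  rw [dotProduct_smul, dotProduct_smul, dotProduct_comm x, smul_eq_mul, smul_eq_mul]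
  ring

end Matrix.IsHermitian

theorem exists_pair_orthogonal (p q : ℝ) : ∃ a b : ℝ, a * p + b * q = 0 ∧ 0 < a ^ 2 + b ^ 2 := by
  by_cases h : p = 0
  · exact ⟨1, 0, by simp [h], by norm_num⟩
  · exact ⟨-q, p, by ring, by positivity⟩

/-! ### Variational bounds on the second eigenvalue. -/

section AlgebraicConnectivity

variable {V : Type*} [Fintype V] [DecidableEq V] (G : SimpleGraph V) [DecidableRel G.Adj]
  (hV : 1 < Fintype.card V)

/-- The span of the two bottom eigenvectors contains a nonzero vector of sum zero, whose Rayleigh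
quotient is at most the second eigenvalue. -/
theorem le_algebraicConnectivity {c : ℝ}
    (h : ∀ x : V → ℝ, ∑ v, x v = 0 → c * (x ⬝ᵥ x) ≤ x ⬝ᵥ G.lapMatrix ℝ *ᵥ x) :
    c ≤ algebraicConnectivity G hV := by
  set hA := G.isHermitian_lapMatrix (R := ℝ)
  -- `eigenvalues₀` is nonincreasing, so reversal makes `l` the smallest index and `s` the second
  -- smallest, in order of eigenvalue.
  set s : Fin (Fintype.card V) := Fin.rev ⟨1, hV⟩
  set l : Fin (Fintype.card V) := Fin.rev ⟨0, by omega⟩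
  have hsl : s ≠ l := by simp [s, l, Fin.ext_iff]; omega
  have hμ : hA.eigenvalues₀ l ≤ hA.eigenvalues₀ s :=
    hA.eigenvalues₀_antitone (by simp [s, l])
  change c ≤ hA.eigenvalues₀ s
  obtain ⟨a, b, hab, hpos⟩ :=
    exists_pair_orthogonal (∑ v, hA.eigenvector₀ l v) (∑ v, hA.eigenvector₀ s v)
  have h1 := h (a • hA.eigenvector₀ l + b • hA.eigenvector₀ s)
    (by simpa [Finset.sum_add_distrib, ← Finset.mul_sum] using hab)
  simp only [mulVec_add, mulVec_smul, hA.mulVec_eigenvector₀, dotProduct_add, add_dotProduct,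
    dotProduct_smul, smul_dotProduct, hA.eigenvector₀_dotProduct, hsl, hsl.symm, if_true, if_false,
    smul_eq_mul] at h1
  nlinarith [mul_nonneg (sq_nonneg a) (sub_nonneg.2 hμ)]

/-- Dually, the span of `1` and `x` contains a nonzero `u` orthogonal to the bottom eigenvector. The
constant part of `u` adds to its norm but not to its energy, so its quotient is still at most `c`.
-/
theorem algebraicConnectivity_le {c : ℝ} {x : V → ℝ} (hx : x ≠ 0) (hx₁ : ∑ v, x v = 0)
    (h : x ⬝ᵥ G.lapMatrix ℝ *ᵥ x ≤ c * (x ⬝ᵥ x)) : algebraicConnectivity G hV ≤ c := by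
  set hA := G.isHermitian_lapMatrix (R := ℝ)
  set s : Fin (Fintype.card V) := Fin.rev ⟨1, hV⟩
  set l : Fin (Fintype.card V) := Fin.rev ⟨0, by omega⟩
  change hA.eigenvalues₀ s ≤ c
  have hxx : 0 < x ⬝ᵥ x := by
    obtain ⟨v, hv⟩ := Function.ne_iff.1 hx
    exact Finset.sum_pos' (fun i _ => mul_self_nonneg _) ⟨v, Finset.mem_univ v, mul_self_pos.2 hv⟩
  have hpsd : 0 ≤ x ⬝ᵥ G.lapMatrix ℝ *ᵥ x := by
    simpa using (G.posSemidef_lapMatrix ℝ).dotProduct_mulVec_nonneg x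
  have hc : 0 ≤ c := nonneg_of_mul_nonneg_left (hpsd.trans h) hxx
  set o : V → ℝ := fun _ => 1
  have hAo : G.lapMatrix ℝ *ᵥ o = 0 := G.lapMatrix_mulVec_const_eq_zero
  have hoo : o ⬝ᵥ o = Fintype.card V := by simp [o, dotProduct]
  have hox : o ⬝ᵥ x = 0 := by simpa [o, dotProduct] using hx₁
  have hoA : o ⬝ᵥ G.lapMatrix ℝ *ᵥ x = 0 := by
    rw [dotProduct_mulVec, ← mulVec_transpose, (G.isSymm_lapMatrix (R := ℝ)).eq, hAo,
      zero_dotProduct]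
  obtain ⟨a, b, hab, hpos⟩ := exists_pair_orthogonal (hA.eigenvector₀ l ⬝ᵥ o)
    (hA.eigenvector₀ l ⬝ᵥ x)
  set u := a • o + b • x with hu
  have hlu : hA.eigenvector₀ l ⬝ᵥ u = 0 := by
    simpa [hu, dotProduct_add, dotProduct_smul] using hab
  have huu : u ⬝ᵥ u = a ^ 2 * Fintype.card V + b ^ 2 * (x ⬝ᵥ x) := by
    simp only [hu, dotProduct_add, add_dotProduct, dotProduct_smul, smul_dotProduct, hoo, hox,
      dotProduct_comm x o, smul_eq_mul]
    ring
  have huA : u ⬝ᵥ G.lapMatrix ℝ *ᵥ u = b ^ 2 * (x ⬝ᵥ G.lapMatrix ℝ *ᵥ x) := by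
    simp only [hu, mulVec_add, mulVec_smul, hAo, dotProduct_add, add_dotProduct, dotProduct_smul,
      smul_dotProduct, hoA, smul_eq_mul, dotProduct_zero]
    ring
  have hcard : (0 : ℝ) < Fintype.card V := by exact_mod_cast (by omega : 0 < Fintype.card V)
  have hupos : 0 < u ⬝ᵥ u := by
    rw [huu]
    rcases eq_or_ne a 0 with ha | ha
    · have : 0 < b ^ 2 := by simpa [ha] using hpos
      positivity
    · positivity
  have hlow : hA.eigenvalues₀ s * (u ⬝ᵥ u) ≤ u ⬝ᵥ G.lapMatrix ℝ *ᵥ u := by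
    rw [hA.dotProduct_mulVec_eq_sum, hA.dotProduct_self_eq_sum, Finset.mul_sum]
    refine Finset.sum_le_sum fun i _ => ?_
    rcases eq_or_ne i l with rfl | hi
    · simp [hlu]
    · refine mul_le_mul_of_nonneg_right (hA.eigenvalues₀_antitone ?_) (sq_nonneg _)
      simp only [s, l, Fin.le_def, Fin.ext_iff, Fin.val_rev, ne_eq] at hi ⊢
      omega
  refine le_of_mul_le_mul_right (hlow.trans ?_) hupos
  rw [huA, huu]
  nlinarith [mul_le_mul_of_nonneg_left h (sq_nonneg b),
    mul_nonneg hc (mul_nonneg (sq_nonneg a) hcard.le)]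

theorem dotProduct_lapMatrix_mulVec (x : V → ℝ) :
    x ⬝ᵥ G.lapMatrix ℝ *ᵥ x = (∑ i, ∑ j, if G.Adj i j then (x i - x j) ^ 2 else 0) / 2 := by
  rw [← G.lapMatrix_toLinearMap₂' ℝ x, toLinearMap₂'_apply']

theorem dotProduct_lapMatrix_mulVec_le (x : V → ℝ) :
    x ⬝ᵥ G.lapMatrix ℝ *ᵥ x ≤ 2 * ∑ i, G.degree i * x i ^ 2 := by
  have h1 : ∑ i, ∑ j, (if G.Adj i j then x i ^ 2 else 0) = ∑ i, G.degree i * x i ^ 2 := by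
    simp only [G.degree_eq_sum_if_adj (R := ℝ), Finset.sum_mul, ite_mul, one_mul, zero_mul]
  have h2 : ∑ i, ∑ j, (if G.Adj i j then x j ^ 2 else 0) = ∑ i, G.degree i * x i ^ 2 := by
    rw [Finset.sum_comm, ← h1]
    simp only [G.adj_comm]
  have h3 : ∑ i, ∑ j, (if G.Adj i j then (x i - x j) ^ 2 else 0)
      ≤ ∑ i, ∑ j, (2 * (if G.Adj i j then x i ^ 2 else 0)
        + 2 * (if G.Adj i j then x j ^ 2 else 0)) := by
    refine Finset.sum_le_sum fun i _ => Finset.sum_le_sum fun j _ => ?_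
    split_ifs
    · nlinarith [sq_nonneg (x i + x j)]
    · simp
  simp only [Finset.sum_add_distrib, ← Finset.mul_sum, h1, h2] at h3
  rw [dotProduct_lapMatrix_mulVec]
  linarith

theorem sum_sum_sub_sq {V : Type*} [Fintype V] {x : V → ℝ} (hx : ∑ v, x v = 0) :
    ∑ i, ∑ j, (x i - x j) ^ 2 = 2 * Fintype.card V * (x ⬝ᵥ x) := by
  simp only [sub_sq, Finset.sum_add_distrib, Finset.sum_sub_distrib, ← Finset.mul_sum,
    ← Finset.sum_mul, hx, Finset.sum_const, Finset.card_univ, nsmul_eq_mul, dotProduct, ← sq]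
  ring

theorem dotProduct_lapMatrix_mulVec_add_compl {x : V → ℝ} (hx : ∑ v, x v = 0) :
    x ⬝ᵥ G.lapMatrix ℝ *ᵥ x + x ⬝ᵥ Gᶜ.lapMatrix ℝ *ᵥ x = Fintype.card V * (x ⬝ᵥ x) := by
  have h : ∑ i, ∑ j, (x i - x j) ^ 2 = ∑ i, ∑ j, ((if G.Adj i j then (x i - x j) ^ 2 else 0)
      + if Gᶜ.Adj i j then (x i - x j) ^ 2 else 0) := by
    refine Finset.sum_congr rfl fun i _ => Finset.sum_congr rfl fun j _ => ?_
    rcases eq_or_ne i j with rfl | hij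
    · simp
    · by_cases hG : G.Adj i j <;> simp [hG, hij]
  rw [sum_sum_sub_sq hx] at h
  simp only [Finset.sum_add_distrib] at h
  rw [dotProduct_lapMatrix_mulVec, dotProduct_lapMatrix_mulVec]
  linarith

theorem two_mul_sub_card_add_two_le_algebraicConnectivity {d : ℕ} (hd : ∀ v, d ≤ G.degree v) :
    2 * (d : ℝ) - Fintype.card V + 2 ≤ algebraicConnectivity G hV := by
  refine le_algebraicConnectivity G hV fun x hx => ?_
  have h1 := dotProduct_lapMatrix_mulVec_add_compl G hx
  have h2 := dotProduct_lapMatrix_mulVec_le Gᶜ x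
  have h3 : ∑ i, (Gᶜ.degree i : ℝ) * x i ^ 2 ≤ (Fintype.card V - 1 - d : ℝ) * (x ⬝ᵥ x) := by
    rw [dotProduct, Finset.mul_sum]
    refine Finset.sum_le_sum fun i _ => ?_
    rw [← sq]
    refine mul_le_mul_of_nonneg_right ?_ (sq_nonneg _)
    have h4 := G.degree_lt_card_verts i
    have h5 : Gᶜ.degree i + d + 1 ≤ Fintype.card V := by
      have := hd i
      rw [G.degree_compl]
      omega
    have : (Gᶜ.degree i + d + 1 : ℝ) ≤ Fintype.card V := by exact_mod_cast h5
    linarith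
  nlinarith

end AlgebraicConnectivity

/-! ### Lag energies and the Poincaré inequality. -/

/-- The energy at distance `d` of the first `n` terms of a sequence. -/
def lagEnergy (y : ℕ → ℝ) (n d : ℕ) : ℝ := ∑ i ∈ Finset.range (n - d), (y (i + d) - y i) ^ 2

theorem lagEnergy_nonneg (y : ℕ → ℝ) (n d : ℕ) : 0 ≤ lagEnergy y n d :=
  Finset.sum_nonneg fun _ _ => sq_nonneg _

@[simp]
theorem lagEnergy_zero (y : ℕ → ℝ) (n : ℕ) : lagEnergy y n 0 = 0 := by simp [lagEnergy]

theorem sqrt_sum_add_sq_le {ι : Type*} (s : Finset ι) (f g : ι → ℝ) :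
    √(∑ i ∈ s, (f i + g i) ^ 2) ≤ √(∑ i ∈ s, f i ^ 2) + √(∑ i ∈ s, g i ^ 2) := by
  refine Real.sqrt_le_iff.2 ⟨by positivity, ?_⟩
  have h := Real.sum_mul_le_sqrt_mul_sqrt s f g
  rw [add_sq, Real.sq_sqrt (Finset.sum_nonneg fun _ _ => sq_nonneg _),
    Real.sq_sqrt (Finset.sum_nonneg fun _ _ => sq_nonneg _)]
  simp only [add_sq, Finset.sum_add_distrib, mul_assoc, ← Finset.mul_sum]
  linarith

theorem sqrt_lagEnergy_add_le (y : ℕ → ℝ) (n a b : ℕ) :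
    √(lagEnergy y n (a + b)) ≤ √(lagEnergy y n a) + √(lagEnergy y n b) := by
  have h := sqrt_sum_add_sq_le (Finset.range (n - (a + b)))
    (fun i => y (i + a) - y i) (fun i => y (i + a + b) - y (i + a))
  have h1 : lagEnergy y n (a + b) = ∑ i ∈ Finset.range (n - (a + b)),
      (y (i + a) - y i + (y (i + a + b) - y (i + a))) ^ 2 := by
    refine Finset.sum_congr rfl fun i _ => ?_
    rw [← add_assoc]
    ring
  rw [h1]
  refine h.trans (add_le_add (Real.sqrt_le_sqrt ?_) (Real.sqrt_le_sqrt ?_))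
  · exact Finset.sum_le_sum_of_subset_of_nonneg
      (Finset.range_subset_range.2 (by omega)) fun _ _ _ => sq_nonneg _
  · have h2 : ∑ i ∈ Finset.range (n - (a + b)), (y (i + a + b) - y (i + a)) ^ 2
        = ∑ i ∈ (Finset.range (n - (a + b))).map (addRightEmbedding a), (y (i + b) - y i) ^ 2 := by
      simp
    rw [h2]
    refine Finset.sum_le_sum_of_subset_of_nonneg (fun i hi => ?_) fun _ _ _ => sq_nonneg _
    simp only [Finset.mem_map, Finset.mem_range, addRightEmbedding_apply] at hi ⊢
    omega

theorem sqrt_lagEnergy_mul_le (y : ℕ → ℝ) (n m a : ℕ) :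
    √(lagEnergy y n (m * a)) ≤ m * √(lagEnergy y n a) := by
  induction m with
  | zero => simp
  | succ m ih =>
    rw [Nat.succ_mul]
    refine (sqrt_lagEnergy_add_le y n _ _).trans ?_
    push_cast
    linarith

/-- Subadditivity of `√E`, then Cauchy–Schwarz over the `2m + 1` summands. -/
theorem lagEnergy_mul_add_add_le (y : ℕ → ℝ) (n m a b r : ℕ) :
    lagEnergy y n (m * (a + b) + r)
      ≤ (2 * m + 1) * (m * (lagEnergy y n a + lagEnergy y n b) + lagEnergy y n r) := by
  set R : ℕ → ℝ := fun d => √(lagEnergy y n d) with hR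
  have hsq : ∀ d, lagEnergy y n d = R d ^ 2 := fun d => (Real.sq_sqrt (lagEnergy_nonneg y n d)).symm
  have h0 : R (m * (a + b) + r) ≤ m * (R a + R b) + R r := by
    have h1 := sqrt_lagEnergy_add_le y n (m * (a + b)) r
    have h2 := sqrt_lagEnergy_mul_le y n m (a + b)
    have h3 := mul_le_mul_of_nonneg_left (sqrt_lagEnergy_add_le y n a b) (Nat.cast_nonneg (α := ℝ) m)
    simp only [hR]
    linarith
  rw [hsq, hsq a, hsq b, hsq r]
  refine (pow_le_pow_left₀ (Real.sqrt_nonneg _) h0 2).trans ?_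
  have hm : (0 : ℝ) ≤ m := Nat.cast_nonneg m
  nlinarith [mul_nonneg (mul_nonneg hm hm) (sq_nonneg (R a - R b)),
    mul_nonneg hm (sq_nonneg (R a - R r)), mul_nonneg hm (sq_nonneg (R b - R r))]

/-- Sum over the `k` splittings of `k + 1` into two positive lags; each lag from `1` to `k` occurs
twice. -/
theorem mul_lagEnergy_le (y : ℕ → ℝ) (n k m r : ℕ) :
    k * lagEnergy y n (m * (k + 1) + r)
      ≤ (2 * m + 1) * (2 * m * ∑ d ∈ Finset.range (k + 1), lagEnergy y n d
        + k * lagEnergy y n r) := by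
  have h : ∑ d ∈ Finset.range k, lagEnergy y n (m * (k + 1) + r) ≤ ∑ d ∈ Finset.range k,
      (2 * m + 1) * (m * (lagEnergy y n (d + 1) + lagEnergy y n (k - 1 - d + 1))
        + lagEnergy y n r) := by
    refine Finset.sum_le_sum fun d hd => ?_
    have hd := Finset.mem_range.1 hd
    have := lagEnergy_mul_add_add_le y n m (d + 1) (k - 1 - d + 1) r
    rwa [show d + 1 + (k - 1 - d + 1) = k + 1 by omega] at this
  rw [← Finset.mul_sum, Finset.sum_add_distrib, ← Finset.mul_sum, Finset.sum_add_distrib,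
    Finset.sum_range_reflect (fun d => lagEnergy y n (d + 1)) k] at h
  rw [Finset.sum_range_succ', lagEnergy_zero]
  simp only [Finset.sum_const, Finset.card_range, nsmul_eq_mul] at h
  linarith

theorem mul_sum_range_lagEnergy_le (y : ℕ → ℝ) (n k m t : ℕ) (ht : t ≤ k + 1) :
    k * ∑ r ∈ Finset.range t, lagEnergy y n (m * (k + 1) + r)
      ≤ (2 * m + 1) * (2 * m * t + k) * ∑ d ∈ Finset.range (k + 1), lagEnergy y n d := by
  have h := Finset.sum_le_sum fun r (_ : r ∈ Finset.range t) => mul_lagEnergy_le y n k m r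
  simp only [← Finset.mul_sum, Finset.sum_add_distrib, Finset.sum_const, Finset.card_range,
    nsmul_eq_mul] at h
  have h2 : ∑ r ∈ Finset.range t, lagEnergy y n r ≤ ∑ d ∈ Finset.range (k + 1), lagEnergy y n d :=
    Finset.sum_le_sum_of_subset_of_nonneg
      (Finset.range_subset_range.2 ht) fun _ _ _ => lagEnergy_nonneg _ _ _
  refine h.trans ?_
  have : (2 * m + 1 : ℝ) * (k * ∑ r ∈ Finset.range t, lagEnergy y n r)
      ≤ (2 * m + 1) * (k * ∑ d ∈ Finset.range (k + 1), lagEnergy y n d) := by gcongr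
  linarith

theorem three_mul_mul_sum_range_lagEnergy_le (y : ℕ → ℝ) (n k m : ℕ) :
    3 * (k * ∑ d ∈ Finset.range (m * (k + 1)), lagEnergy y n d)
      ≤ (m * (m - 1) * (4 * m + 1) * (k + 1) + 3 * m ^ 2 * k)
        * ∑ d ∈ Finset.range (k + 1), lagEnergy y n d := by
  induction m with
  | zero => simp
  | succ m ih =>
    have h := mul_sum_range_lagEnergy_le y n k m (k + 1) le_rfl
    rw [Nat.succ_mul, Finset.sum_range_add]
    push_cast at h ⊢
    linarith

theorem polynomial_bound {k m s : ℝ} (hk : 1 ≤ k) (hm : 1 ≤ m) (hs : 0 ≤ s) :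
    (m * (m - 1) * (4 * m + 1) * (k + 1) + 3 * m ^ 2 * k
        + 3 * ((2 * m + 1) * (2 * m * (s + 1) + k))) * (k + 1) ^ 2
      ≤ 12 * (m * (k + 1) + s + 1) * (m * (k + 1) + s) ^ 2 := by
  -- After shifting `k` and `m` by one, the difference of the sides has only nonnegative
  -- coefficients.
  obtain ⟨k, rfl⟩ : ∃ k', k = k' + 1 := ⟨k - 1, by ring⟩
  obtain ⟨m, rfl⟩ : ∃ m', m = m' + 1 := ⟨m - 1, by ring⟩
  have hk' : 0 ≤ k := by linarith
  have hm' : 0 ≤ m := by linarith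
  rw [← sub_nonneg]
  ring_nf
  positivity

/-- Discrete Poincaré inequality. -/
theorem mul_sum_lagEnergy_le (y : ℕ → ℝ) {n k : ℕ} (hk : 1 ≤ k) (hkn : k < n) :
    k * (k + 1) ^ 2 * ∑ d ∈ Finset.range n, lagEnergy y n d
      ≤ 4 * n * (n - 1) ^ 2 * ∑ d ∈ Finset.range (k + 1), lagEnergy y n d := by
  set Q := ∑ d ∈ Finset.range (k + 1), lagEnergy y n d with hQ
  have hQ0 : 0 ≤ Q := Finset.sum_nonneg fun _ _ => lagEnergy_nonneg _ _ _
  have hk1 : (1 : ℝ) ≤ k := by exact_mod_cast hk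
  obtain ⟨N, rfl⟩ : ∃ N, n = N + 1 := ⟨n - 1, by omega⟩
  -- The largest lag `N = n - 1` is divided by `k + 1`, giving `m` full blocks of lags and a last
  -- one of length `s + 1`. Quotient `0` forces `N = k`.
  obtain ⟨m, s, hs, hN⟩ : ∃ m s, s < k + 1 ∧ N = m * (k + 1) + s :=
    ⟨N / (k + 1), N % (k + 1), Nat.mod_lt _ (by omega), (Nat.div_add_mod' N (k + 1)).symm⟩
  rcases Nat.eq_zero_or_pos m with rfl | hm
  · obtain rfl : N = k := by omega
    rw [← hQ]
    refine mul_le_mul_of_nonneg_right ?_ hQ0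
    push_cast
    nlinarith [mul_nonneg (by linarith : (0:ℝ) ≤ (N:ℝ) - 1) (by positivity : (0 : ℝ) ≤ N * (N + 1))]
  · have h1 := three_mul_mul_sum_range_lagEnergy_le y (N + 1) k m
    have h2 := mul_sum_range_lagEnergy_le y (N + 1) k m (s + 1) (by omega)
    rw [← hQ] at h1 h2
    have h3 := polynomial_bound hk1 (show (1 : ℝ) ≤ m by exact_mod_cast hm) (Nat.cast_nonneg s)
    have hsum : ∑ d ∈ Finset.range (N + 1), lagEnergy y (N + 1) d
        = ∑ d ∈ Finset.range (m * (k + 1)), lagEnergy y (N + 1) d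
          + ∑ r ∈ Finset.range (s + 1), lagEnergy y (N + 1) (m * (k + 1) + r) := by
      rw [← Finset.sum_range_add, ← add_assoc, ← hN]
    have h4 := mul_le_mul_of_nonneg_right h3 hQ0
    have hNc : (N : ℝ) = m * (k + 1) + s := by rw [hN]; push_cast; ring
    push_cast at h2 ⊢
    have h5 : 3 * (k * ∑ d ∈ Finset.range (N + 1), lagEnergy y (N + 1) d) * (k + 1 : ℝ) ^ 2
        ≤ ((m * (m - 1) * (4 * m + 1) * (k + 1) + 3 * m ^ 2 * k
        + 3 * ((2 * m + 1) * (2 * m * (s + 1) + k))) * Q) * (k + 1) ^ 2 := by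
      refine mul_le_mul_of_nonneg_right ?_ (by positivity)
      rw [hsum]
      linarith
    rw [hNc]
    linarith

/-! ### The platoon's quadratic form and degrees. -/

theorem sum_range_sum_range_symm (g : ℕ → ℕ → ℝ) (hg : ∀ i j, g i j = g j i) (hg₀ : ∀ i, g i i = 0)
    (n : ℕ) : ∑ i ∈ Finset.range n, ∑ j ∈ Finset.range n, g i j
      = 2 * ∑ d ∈ Finset.range n, ∑ i ∈ Finset.range (n - d), g i (i + d) := by
  induction n with
  | zero => simp
  | succ n ih =>
    have h1 : ∑ d ∈ Finset.range (n + 1), ∑ i ∈ Finset.range (n + 1 - d), g i (i + d)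
        = ∑ d ∈ Finset.range (n + 1), (∑ i ∈ Finset.range (n - d), g i (i + d) + g (n - d) n) := by
      refine Finset.sum_congr rfl fun d hd => ?_
      have hd := Finset.mem_range.1 hd
      rw [show n + 1 - d = n - d + 1 by omega, Finset.sum_range_succ, show n - d + d = n by omega]
    have h2 := Finset.sum_range_reflect (fun d => g d n) (n + 1)
    simp only [Nat.add_sub_cancel] at h2
    rw [h1, Finset.sum_add_distrib, h2, Finset.sum_range_succ (fun d => g d n),
      Finset.sum_range_succ (fun d => ∑ i ∈ Finset.range (n - d), g i (i + d)), hg₀]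
    simp only [Finset.sum_range_succ, Finset.sum_add_distrib, ih, hg₀, hg n]
    simp
    ring

theorem sum_sum_if_lag_le (y : ℕ → ℝ) {n k : ℕ} (hkn : k < n) :
    ∑ i ∈ Finset.range n, ∑ j ∈ Finset.range n,
        (if i ≤ j + k ∧ j ≤ i + k then (y i - y j) ^ 2 else 0)
      = 2 * ∑ d ∈ Finset.range (k + 1), lagEnergy y n d := by
  rw [sum_range_sum_range_symm _ (fun i j => ?_) (fun i => by simp)]
  · congr 1
    rw [← Finset.sum_subset (Finset.range_subset_range.2 (show k + 1 ≤ n by omega))]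
    · refine Finset.sum_congr rfl fun d hd => Finset.sum_congr rfl fun i _ => ?_
      have hd := Finset.mem_range.1 hd
      rw [if_pos (by omega)]
      ring
    · intro d _ hd
      rw [Finset.mem_range, not_lt] at hd
      exact Finset.sum_eq_zero fun i _ => if_neg (by omega)
  · simp only [and_comm]
    rw [← neg_sub, neg_sq]

theorem platoon_dotProduct_lapMatrix_mulVec (y : ℕ → ℝ) {n k : ℕ} (hkn : k < n) :
    (fun i : Fin n => y i) ⬝ᵥ (platoon n k).lapMatrix ℝ *ᵥ (fun i : Fin n => y i)
      = ∑ d ∈ Finset.range (k + 1), lagEnergy y n d := by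
  have h : ∑ i : Fin n, ∑ j : Fin n, (if (platoon n k).Adj i j then (y i - y j) ^ 2 else 0)
      = ∑ i ∈ Finset.range n, ∑ j ∈ Finset.range n,
        (if i ≤ j + k ∧ j ≤ i + k then (y i - y j) ^ 2 else 0) := by
    rw [← Fin.sum_univ_eq_sum_range
      (fun i => ∑ j ∈ Finset.range n, if i ≤ j + k ∧ j ≤ i + k then (y i - y j) ^ 2 else 0)]
    refine Finset.sum_congr rfl fun i _ => ?_
    rw [← Fin.sum_univ_eq_sum_range
      (fun j => if (i : ℕ) ≤ j + k ∧ j ≤ (i : ℕ) + k then (y i - y j) ^ 2 else 0)]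
    refine Finset.sum_congr rfl fun j _ => ?_
    rcases eq_or_ne i j with rfl | hij
    · simp
    · simp only [platoon, ne_eq, hij, not_false_eq_true, true_and]
  rw [dotProduct_lapMatrix_mulVec, h, sum_sum_if_lag_le y hkn]
  ring

theorem mul_dotProduct_eq_sum_lagEnergy (y : ℕ → ℝ) {n : ℕ} (hn : 0 < n)
    (hy : ∑ i : Fin n, y i = 0) :
    n * ((fun i : Fin n => y i) ⬝ᵥ (fun i : Fin n => y i))
      = ∑ d ∈ Finset.range n, lagEnergy y n d := by
  -- With `k = n - 1` the lag condition admits every pair.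
  have h := sum_sum_if_lag_le y (show n - 1 < n by omega)
  rw [Nat.sub_add_cancel hn] at h
  have h2 := sum_sum_sub_sq hy
  have h3 : ∑ i : Fin n, ∑ j : Fin n, (y i - y j) ^ 2
      = ∑ i ∈ Finset.range n, ∑ j ∈ Finset.range n,
        (if i ≤ j + (n - 1) ∧ j ≤ i + (n - 1) then (y i - y j) ^ 2 else 0) := by
    rw [← Fin.sum_univ_eq_sum_range (fun i => ∑ j ∈ Finset.range n,
      if i ≤ j + (n - 1) ∧ j ≤ i + (n - 1) then (y i - y j) ^ 2 else 0)]
    refine Finset.sum_congr rfl fun i _ => ?_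
    rw [← Fin.sum_univ_eq_sum_range (fun j =>
      if (i : ℕ) ≤ j + (n - 1) ∧ j ≤ (i : ℕ) + (n - 1) then (y i - y j) ^ 2 else 0)]
    refine Finset.sum_congr rfl fun j _ => (if_pos (by omega)).symm
  rw [Fintype.card_fin] at h2
  linarith

theorem le_degree_platoon {n k : ℕ} (hkn : k < n) (v : Fin n) : k ≤ (platoon n k).degree v := by
  have hsub : (Finset.univ.filter fun j : Fin n => v ≠ j ∧ (v : ℕ) ≤ j + k ∧ (j : ℕ) ≤ v + k)
      = (platoon n k).neighborFinset v := by
    ext j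
    simp only [Finset.mem_filter, Finset.mem_univ, true_and, SimpleGraph.mem_neighborFinset]
    rfl
  rw [SimpleGraph.degree, ← hsub]
  have h : ((Finset.Icc ((v : ℕ) - k) (min (v + k) (n - 1))).erase v).card
      ≤ (Finset.univ.filter fun j : Fin n => v ≠ j ∧ (v : ℕ) ≤ j + k ∧ (j : ℕ) ≤ v + k).card := by
    refine Finset.card_le_card_of_surjOn (fun j : Fin n => (j : ℕ)) fun j hj => ?_
    simp only [Finset.coe_erase, Finset.coe_Icc, Set.mem_sdiff, Set.mem_Icc, le_inf_iff,
      Set.mem_singleton_iff] at hj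
    refine ⟨⟨j, by omega⟩, ?_, rfl⟩
    simp only [Finset.coe_filter, Finset.mem_univ, true_and, Set.mem_ofPred_eq, ne_eq, Fin.ext_iff]
    omega
  refine le_trans ?_ h
  rw [Finset.card_erase_of_mem (by simp only [Finset.mem_Icc]; omega), Nat.card_Icc]
  omega

/-! ### The cut vector and the final bounds. -/

/-- The vector, constant on the first `m` and on the remaining `n - m` positions, with sum zero. -/
def cutVector (n m : ℕ) (i : ℕ) : ℝ := if i < m then (n : ℝ) - m else -m

/-- At most `d` pairs at lag `d` straddle the cut, each with jump `n`. -/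
theorem lagEnergy_cutVector_le (n m d : ℕ) : lagEnergy (cutVector n m) n d ≤ n ^ 2 * d := by
  have h : ∀ i ∈ Finset.range (n - d), (cutVector n m (i + d) - cutVector n m i) ^ 2
      ≤ if i ∈ Finset.Ico (m - d) m then (n : ℝ) ^ 2 else 0 := by
    intro i _
    unfold cutVector
    simp only [Finset.mem_Ico]
    by_cases h1 : i < m
    · by_cases h2 : i + d < m
      · simp only [h1, h2, if_true, sub_self, ne_eq, OfNat.ofNat_ne_zero, not_false_eq_true,
          zero_pow]
        split_ifs <;> positivity
      · rw [if_neg h2, if_pos h1, if_pos (by omega)]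
        exact le_of_eq (by ring)
    · rw [if_neg (by omega), if_neg h1, if_neg (by omega)]
      simp
  refine (Finset.sum_le_sum h).trans ?_
  rw [← Finset.sum_filter, Finset.sum_const, nsmul_eq_mul, mul_comm]
  refine mul_le_mul_of_nonneg_left ?_ (sq_nonneg _)
  have h2 : ((Finset.range (n - d)).filter (· ∈ Finset.Ico (m - d) m)).card
      ≤ (Finset.Ico (m - d) m).card :=
    Finset.card_le_card fun i hi => (Finset.mem_filter.1 hi).2
  rw [Nat.card_Ico] at h2
  exact_mod_cast h2.trans (by omega)

theorem sum_fin_cutVector (f : ℝ → ℝ) {n m : ℕ} (hm : m ≤ n) :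
    ∑ i : Fin n, f (cutVector n m i) = m * f (n - m) + (n - m) * f (-m) := by
  rw [Fin.sum_univ_eq_sum_range (fun i => f (cutVector n m i))]
  obtain ⟨r, rfl⟩ := Nat.exists_eq_add_of_le hm
  have h1 : ∀ i ∈ Finset.range m, f (cutVector (m + r) m i) = f (r : ℝ) := fun i hi => by
    simp [cutVector, Finset.mem_range.1 hi]
  have h2 : ∀ i ∈ Finset.range r, f (cutVector (m + r) m (m + i)) = f (-m : ℝ) := fun i _ => by
    simp [cutVector]
  rw [Finset.sum_range_add, Finset.sum_congr rfl h1, Finset.sum_congr rfl h2]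
  simp

theorem algebraicConnectivity_platoon_le {n k : ℕ} (hk : 1 ≤ k) (hkn : k < n) :
    algebraicConnectivity (platoon n k) (one_lt_card_fin_of_lt hk hkn)
      ≤ 2 * (k : ℝ) * ((k : ℝ) + 1) / ((n / 2 : ℕ) : ℝ) := by
  set m := n / 2 with hm
  have hm0 : (0 : ℝ) < m := by exact_mod_cast (by omega : 0 < m)
  have hmn : m ≤ n := by omega
  have hn0 : (0 : ℝ) < n := by exact_mod_cast (by omega : 0 < n)
  have h2m : (n : ℝ) ≤ 2 * (n - m) := by
    have : (2 * m : ℝ) ≤ n := by exact_mod_cast (by omega : 2 * m ≤ n)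
    linarith
  have hdot : (fun i : Fin n => cutVector n m i) ⬝ᵥ (fun i : Fin n => cutVector n m i)
      = n * m * (n - m) := by
    rw [dotProduct, sum_fin_cutVector (fun x => x * x) hmn]
    ring
  refine algebraicConnectivity_le _ _ (x := fun i : Fin n => cutVector n m i) ?_ ?_ ?_
  · intro h
    rw [h, zero_dotProduct] at hdot
    have : 0 < (n : ℝ) * m * (n - m) := mul_pos (mul_pos hn0 hm0) (by linarith)
    linarith
  · have := sum_fin_cutVector id hmn
    simp only [id] at this
    rw [this]
    ring
  · rw [platoon_dotProduct_lapMatrix_mulVec _ hkn, hdot]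
    have h1 : ∑ d ∈ Finset.range (k + 1), lagEnergy (cutVector n m) n d
        ≤ n ^ 2 * ∑ d ∈ Finset.range (k + 1), (d : ℝ) := by
      rw [Finset.mul_sum]
      exact Finset.sum_le_sum fun d _ => lagEnergy_cutVector_le n m d
    have h2 : (∑ d ∈ Finset.range (k + 1), (d : ℝ)) * 2 = (k + 1) * k := by
      have := Finset.sum_range_id_mul_two (k + 1)
      rw [Nat.add_sub_cancel] at this
      rw [← Nat.cast_sum]
      exact_mod_cast this
    have h3 : 2 * (k : ℝ) * (k + 1) / m * (n * m * (n - m)) = 2 * k * (k + 1) * n * (n - m) := by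
      field_simp
    rw [h3]
    have h4 : (k * (k + 1) * n : ℝ) * n ≤ (k * (k + 1) * n) * (2 * (n - m)) :=
      mul_le_mul_of_nonneg_left h2m (by positivity)
    have h5 : (0 : ℝ) ≤ k * (k + 1) * n ^ 2 := by positivity
    nlinarith

theorem le_algebraicConnectivity_platoon {n k : ℕ} (hk : 1 ≤ k) (hkn : k < n) :
    (k : ℝ) * ((k : ℝ) + 1) ^ 2 / (16 * ((n / 2 : ℕ) : ℝ) ^ 2)
      ≤ algebraicConnectivity (platoon n k) (one_lt_card_fin_of_lt hk hkn) := by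
  refine le_algebraicConnectivity _ _ fun x hx => ?_
  -- The extension by zero is harmless: `lagEnergy y n d` only reads `y` below `n`.
  set y : ℕ → ℝ := fun i => if h : i < n then x ⟨i, h⟩ else 0 with hy
  have hxy : x = fun i : Fin n => y i := by
    ext i
    simp [hy]
  rw [hxy] at hx ⊢
  have h1 := mul_dotProduct_eq_sum_lagEnergy y (by omega) hx
  have h2 := mul_sum_lagEnergy_le y hk hkn
  rw [platoon_dotProduct_lapMatrix_mulVec _ hkn]
  rw [← h1] at h2
  set Q := ∑ d ∈ Finset.range (k + 1), lagEnergy y n d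
  have hQ : 0 ≤ Q := Finset.sum_nonneg fun _ _ => lagEnergy_nonneg _ _ _
  have hn0 : (0 : ℝ) < n := by exact_mod_cast (by omega : 0 < n)
  have hn1 : (1 : ℝ) ≤ n := by exact_mod_cast (by omega : 1 ≤ n)
  have hm0 : (0 : ℝ) < (n / 2 : ℕ) := by exact_mod_cast (by omega : 0 < n / 2)
  have hnm : (n : ℝ) ≤ 2 * (n / 2 : ℕ) + 1 := by exact_mod_cast (by omega : n ≤ 2 * (n / 2) + 1)
  have h3 : (k * (k + 1) ^ 2 : ℝ) * ((fun i : Fin n => y i) ⬝ᵥ (fun i : Fin n => y i))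
      ≤ 4 * (n - 1) ^ 2 * Q := by
    refine le_of_mul_le_mul_left ?_ hn0
    linarith
  -- From `n - 1 ≤ 2 (n / 2)`; this is the source of the `16`.
  have h4 : 4 * ((n : ℝ) - 1) ^ 2 ≤ 16 * ((n / 2 : ℕ) : ℝ) ^ 2 := by nlinarith
  rw [div_mul_eq_mul_div, div_le_iff₀ (by positivity), mul_comm Q]
  exact h3.trans (mul_le_mul_of_nonneg_right h4 hQ)

theorem proposition1 (n k : ℕ) (hk : 1 ≤ k) (hkn : k < n) :
    max (2 * (k : ℝ) - (n : ℝ) + 2)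
        ((k : ℝ) * ((k : ℝ) + 1) ^ 2 / (16 * ((n / 2 : ℕ) : ℝ) ^ 2))
      ≤ algebraicConnectivity (platoon n k) (one_lt_card_fin_of_lt hk hkn) ∧
    algebraicConnectivity (platoon n k) (one_lt_card_fin_of_lt hk hkn)
      ≤ 2 * (k : ℝ) * ((k : ℝ) + 1) / ((n / 2 : ℕ) : ℝ) := by
  refine ⟨max_le ?_ (le_algebraicConnectivity_platoon hk hkn),
    algebraicConnectivity_platoon_le hk hkn⟩
  simpa using two_mul_sub_card_add_two_le_algebraicConnectivity (platoon n k)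
    (one_lt_card_fin_of_lt hk hkn) (le_degree_platoon hkn)
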